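/- Theorem. Let $H=(V,E)$ be a finite simple graph. A set $A\subseteq\mathbb R^n$ is called an induced unit-copy of $H$ if there is a bijection $f\colon V\to A$ such that, for all distinct $u,v\in V$, $\|f(u)-f(v)\|=1$ if $uv\in E$ and $\|f(u)-f(v)\|\neq 1$ if $uv\notin E$, where $\|\cdot\|$ is the Euclidean norm. Then for every sufficiently large $n$ (that is, there is $n_0=n_0(H)$ such that for every $n\ge n_0$), every colouring of the points of $\mathbb R^n$, with any (finite or infinite) set of colours, contains an induced unit-copy $A$ of $H$ that is either monochromatic (all points of $A$ have the same colour) or rainbow (distinct points of $A$ have distinct colours). -/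

import Mathlib

/-- `A ⊆ ℝⁿ` is an induced unit-copy of `H`: there is a bijection `f : V(H) → A` under which
adjacent vertices go to points at Euclidean distance one, and distinct non-adjacent vertices
go to points whose Euclidean distance is not one. -/
def IsInducedUnitCopy {V : Type*} (H : SimpleGraph V) {n : ℕ}
    (A : Set (EuclideanSpace ℝ (Fin n))) : Prop :=
  ∃ f : V ≃ A,
    (∀ u v : V, H.Adj u v →
      ‖(f u : EuclideanSpace ℝ (Fin n)) - (f v : EuclideanSpace ℝ (Fin n))‖ = 1) ∧
    (∀ u v : V, u ≠ v → ¬ H.Adj u v →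
      ‖(f u : EuclideanSpace ℝ (Fin n)) - (f v : EuclideanSpace ℝ (Fin n))‖ ≠ 1)

/-- All points of `A` have the same colour under `c`. -/
def IsMonochromatic {X κ : Type*} (c : X → κ) (A : Set X) : Prop :=
  ∀ x ∈ A, ∀ y ∈ A, c x = c y

/-- Distinct points of `A` have distinct colours under `c`. -/
def IsRainbow {X κ : Type*} (c : X → κ) (A : Set X) : Prop :=
  ∀ x ∈ A, ∀ y ∈ A, x ≠ y → c x ≠ c y

/-! It suffices to find a finite graph every colouring of which has a monochromatic or rainbow
induced copy of `H`, and to realise it with edges exactly at distance one. In a lexicographic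
product of `H` with a graph `G` that is Ramsey for `|V|` colours, Hall's theorem on the colour sets
of the fibres yields a rainbow transversal, or else a fibre with fewer than `|V|` colours, which
contains a monochromatic copy. The realisation prescribes a Gram matrix. -/

namespace SimpleGraph

universe u

/-- The lexicographic product: every vertex of `H` is replaced by a copy of `G`. -/
def lexProduct {V W : Type*} (H : SimpleGraph V) (G : SimpleGraph W) : SimpleGraph (V × W) where
  Adj p q := H.Adj p.1 q.1 ∨ p.1 = q.1 ∧ G.Adj p.2 q.2
  symm := ⟨fun _ _ h => h.imp (fun h => h.symm) (fun h => ⟨h.1.symm, h.2.symm⟩)⟩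
  loopless := ⟨fun p h => h.elim (H.loopless.irrefl p.1) (fun h => G.loopless.irrefl p.2 h.2)⟩

/-- The copy of `G` that replaces the vertex `v`. -/
def lexFiber {V W : Type*} (H : SimpleGraph V) (G : SimpleGraph W) (v : V) :
    G ↪g lexProduct H G where
  toFun w := (v, w)
  inj' _ _ h := (Prod.ext_iff.1 h).2
  map_rel_iff' {a b} := by
    change H.Adj v v ∨ v = v ∧ G.Adj a b ↔ G.Adj a b
    simp

/-- A choice of one vertex in every copy of `G` spans a copy of `H`. -/
def lexTransversal {V W : Type*} (H : SimpleGraph V) (G : SimpleGraph W) (g : V → W) :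
    H ↪g lexProduct H G where
  toFun v := (v, g v)
  inj' _ _ h := (Prod.ext_iff.1 h).1
  map_rel_iff' {a b} := by
    change H.Adj a b ∨ a = b ∧ G.Adj (g a) (g b) ↔ H.Adj a b
    refine or_iff_left ?_
    rintro ⟨rfl, h⟩
    exact G.loopless.irrefl _ h

/-- Vertex Ramsey theorem for induced subgraphs and `k` colours. -/
theorem exists_induced_vertex_ramsey {V : Type u} [Finite V] (H : SimpleGraph V) (k : ℕ) :
    ∃ (W : Type u) (_ : Finite W) (G : SimpleGraph W), ∀ (κ : Type*) (c : W → κ),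
      (Set.range c).ncard ≤ k → ∃ f : H ↪g G, ∀ u v, c (f u) = c (f v) := by
  induction k with
  | zero =>
    -- A one-point graph always uses a colour, so the case is vacuous.
    refine ⟨PUnit, inferInstance, ⊥, fun κ c hc => ?_⟩
    rw [Nat.le_zero, Set.ncard_eq_zero (Set.finite_range c)] at hc
    exact absurd hc (Set.range_nonempty c).ne_empty
  | succ k ih =>
    obtain ⟨W, hW, G, hG⟩ := ih
    refine ⟨V × W, inferInstance, lexProduct H G, fun κ c hc => ?_⟩
    rcases isEmpty_or_nonempty (V × W) with hE | ⟨⟨p⟩⟩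
    · rcases isEmpty_or_nonempty V with hV | ⟨⟨v⟩⟩
      · exact ⟨⟨⟨isEmptyElim, fun a => isEmptyElim a⟩, fun {a} => isEmptyElim a⟩,
          fun u => isEmptyElim u⟩
      · obtain ⟨f, -⟩ := hG κ (fun w => c (v, w)) (by
          have : IsEmpty W := ⟨fun w => hE.false (v, w)⟩
          simp [Set.range_eq_empty])
        exact (hE.false (v, f v)).elim
    -- Either the colour of `p` meets every fibre, giving a monochromatic transversal, or some fibre
    -- misses it and has at most `k` colours.
    · by_cases h : ∀ v, ∃ w, c (v, w) = c p
      · choose g hg using h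
        exact ⟨lexTransversal H G g, fun u v => (hg u).trans (hg v).symm⟩
      · push Not at h
        obtain ⟨v, hv⟩ := h
        obtain ⟨f, hf⟩ := hG κ (fun w => c (v, w)) (by
          rw [← Nat.lt_add_one_iff]
          refine lt_of_lt_of_le (Set.ncard_lt_ncard ?_ (Set.finite_range c)) hc
          refine ⟨by rintro _ ⟨w, rfl⟩; exact ⟨_, rfl⟩, fun h => ?_⟩
          obtain ⟨w, hw⟩ := h ⟨p, rfl⟩
          exact hv w hw)
        exact ⟨(lexFiber H G v).comp f, hf⟩

/-- Canonical vertex Ramsey theorem for induced subgraphs. -/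
theorem exists_induced_vertex_canonical_ramsey {V : Type u} [Finite V] (H : SimpleGraph V) :
    ∃ (W : Type u) (_ : Finite W) (G : SimpleGraph W), ∀ (κ : Type*) (c : W → κ),
      ∃ f : H ↪g G, (∀ u v, c (f u) = c (f v)) ∨ Function.Injective (c ∘ f) := by
  classical
  obtain ⟨W, hW, G, hG⟩ := exists_induced_vertex_ramsey H (Nat.card V)
  refine ⟨V × W, inferInstance, lexProduct H G, fun κ c => ?_⟩
  have := Fintype.ofFinite V
  have := Fintype.ofFinite W
  by_cases h : ∀ s : Finset V,
      s.card ≤ (s.biUnion fun v => Finset.univ.image fun w => c (v, w)).card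
  · obtain ⟨g, hg, hgc⟩ := (Finset.all_card_le_biUnion_card_iff_exists_injective _).1 h
    simp only [Finset.mem_image, Finset.mem_univ, true_and] at hgc
    choose w hw using hgc
    refine ⟨lexTransversal H G w, Or.inr ?_⟩
    convert hg using 1
    exact funext hw
  -- If `s` violates Hall's condition, each fibre over `s` sees fewer than `|s| ≤ |V|` colours.
  · push Not at h
    obtain ⟨s, hs⟩ := h
    obtain ⟨v, hv⟩ := Finset.card_pos.1 ((Nat.zero_le _).trans_lt hs)
    obtain ⟨f, hf⟩ := hG κ (fun w => c (v, w)) (by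
      rw [← Set.image_univ, ← Finset.coe_univ, ← Finset.coe_image, Set.ncard_coe_finset,
        Nat.card_eq_fintype_card]
      exact ((Finset.card_le_card (Finset.subset_biUnion_of_mem
        (fun v => Finset.univ.image fun w => c (v, w)) hv)).trans hs.le).trans
          (Finset.card_le_univ s))
    exact ⟨(lexFiber H G v).comp f, Or.inl hf⟩

/-- Every finite graph is an induced unit-distance graph in some Euclidean space. -/
theorem exists_induced_unit_distance {W : Type*} [Fintype W] [DecidableEq W]
    (G : SimpleGraph W) :
    ∃ p : W → EuclideanSpace ℝ (W ⊕ Sym2 W), Function.Injective p ∧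
      ∀ u v, u ≠ v → (‖p u - p v‖ = 1 ↔ G.Adj u v) := by
  classical
  -- Small enough that `degree * s ≤ 1 / 2`, so the square root below is of a nonnegative number.
  set s : ℝ := 1 / (2 * (Fintype.card W + 1)) with hs
  have hs0 : 0 < s := by positivity
  have hdeg (v : W) : 0 ≤ 1 / 2 + s - G.degree v * s := by
    have h1 : (G.degree v : ℝ) ≤ Fintype.card W + 1 := by
      exact_mod_cast (G.degree_lt_card_verts v).le.trans (Nat.le_succ _)
    have h2 : (Fintype.card W + 1 : ℝ) * s = 1 / 2 := by rw [hs]; field_simp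
    nlinarith [mul_le_mul_of_nonneg_right h1 hs0.le]
  -- Scaled incidence rows have inner product `s` on edges and 0 on non-edges; a private coordinate
  -- raises every squared norm to `1 / 2 + s`. Squared distances are then 1 and `1 + 2 * s`.
  let p (v : W) : EuclideanSpace ℝ (W ⊕ Sym2 W) := WithLp.toLp 2 <| Sum.elim
    (fun w => if v = w then √(1 / 2 + s - G.degree v * s) else 0)
    (fun e => √s * G.incMatrix ℝ v e)
  have hp (u v : W) : inner ℝ (p u) (p v) =
      if u = v then 1 / 2 + s else if G.Adj u v then s else 0 := by
    have hM : ∑ e, G.incMatrix ℝ u e * G.incMatrix ℝ v e =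
        if u = v then (G.degree u : ℝ) else if G.Adj u v then 1 else 0 := by
      simpa [Matrix.mul_apply] using congrFun (congrFun (G.incMatrix_mul_transpose (R := ℝ)) u) v
    have hM' : ∑ e, (√s * G.incMatrix ℝ v e) * (√s * G.incMatrix ℝ u e) =
        s * ∑ e, G.incMatrix ℝ u e * G.incMatrix ℝ v e := by
      rw [Finset.mul_sum]
      refine Finset.sum_congr rfl fun e _ => ?_
      linear_combination (G.incMatrix ℝ v e * G.incMatrix ℝ u e) * Real.mul_self_sqrt hs0.le
    have hA : ∑ w, (if v = w then √(1 / 2 + s - G.degree v * s) else 0) *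
        (if u = w then √(1 / 2 + s - G.degree u * s) else 0) =
        if u = v then 1 / 2 + s - G.degree u * s else 0 := by
      by_cases h : u = v
      · subst h
        simp [-one_div, Real.mul_self_sqrt (hdeg u)]
      · simp [h, Ne.symm h]
    rw [PiLp.inner_apply, Fintype.sum_sum_type]
    simp only [p, Sum.elim_inl, Sum.elim_inr, RCLike.inner_apply, conj_trivial]
    rw [hA, hM', hM]
    split_ifs <;> ring
  have hd (u v : W) (h : u ≠ v) : ‖p u - p v‖ ^ 2 = if G.Adj u v then 1 else 1 + 2 * s := by
    rw [norm_sub_sq_real, ← real_inner_self_eq_norm_sq, ← real_inner_self_eq_norm_sq,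
      hp, hp, hp, if_pos rfl, if_pos rfl, if_neg h]
    split_ifs <;> ring
  refine ⟨p, fun u v huv => ?_, fun u v h => ?_⟩
  · by_contra h
    have := hd u v h
    rw [huv, sub_self, norm_zero] at this
    split_ifs at this <;> norm_num at this
    linarith
  · have := hd u v h
    constructor
    · intro h1
      by_contra hn
      rw [h1, if_neg hn] at this
      linarith
    · intro h1
      rw [if_pos h1] at this
      exact (pow_eq_one_iff_of_nonneg (norm_nonneg _) two_ne_zero).1 this

end SimpleGraph

/-- A Euclidean space embeds isometrically in every one of at least the same dimension. -/
theorem EuclideanSpace.exists_linearIsometry {ι : Type*} [Fintype ι] {n : ℕ}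
    (h : Fintype.card ι ≤ n) :
    Nonempty (EuclideanSpace ℝ ι →ₗᵢ[ℝ] EuclideanSpace ℝ (Fin n)) := by
  obtain ⟨e⟩ : Nonempty (ι ↪ Fin n) :=
    Function.Embedding.nonempty_of_card_le (by simpa using h)
  let b := EuclideanSpace.basisFun ι ℝ
  let f := b.toBasis.constr ℝ (EuclideanSpace.basisFun (Fin n) ℝ ∘ e)
  refine ⟨f.isometryOfOrthonormal (v := b.toBasis) (by simp [b.orthonormal]) ?_⟩
  have : f ∘ b.toBasis = EuclideanSpace.basisFun (Fin n) ℝ ∘ e :=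
    funext fun i => b.toBasis.constr_basis ℝ _ i
  rw [this]
  exact (EuclideanSpace.basisFun (Fin n) ℝ).orthonormal.comp e e.injective

theorem mainTheorem9 {V : Type*} [Finite V] (H : SimpleGraph V) :
    ∃ n₀ : ℕ, ∀ n : ℕ, n₀ ≤ n →
      ∀ (κ : Type*) (c : EuclideanSpace ℝ (Fin n) → κ),
        ∃ A : Set (EuclideanSpace ℝ (Fin n)),
          IsInducedUnitCopy H A ∧ (IsMonochromatic c A ∨ IsRainbow c A) := by
  classical
  obtain ⟨W, hW, G, hG⟩ := H.exists_induced_vertex_canonical_ramsey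
  have := Fintype.ofFinite W
  obtain ⟨p, hp, hpd⟩ := G.exists_induced_unit_distance
  refine ⟨Fintype.card (W ⊕ Sym2 W), fun n hn κ c => ?_⟩
  obtain ⟨L⟩ := EuclideanSpace.exists_linearIsometry hn
  obtain ⟨f, hf⟩ := hG κ (fun w => c (L (p w)))
  have hinj : Function.Injective fun v => L (p (f v)) :=
    L.injective.comp (hp.comp f.injective)
  have hnorm (u v : V) (h : u ≠ v) : ‖L (p (f u)) - L (p (f v))‖ = 1 ↔ H.Adj u v := by
    rw [← map_sub, L.norm_map, hpd _ _ (f.injective.ne h), f.map_adj_iff]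
  refine ⟨Set.range fun v => L (p (f v)), ⟨Equiv.ofInjective _ hinj, fun u v h => ?_,
    fun u v h h' => ?_⟩, hf.imp ?_ ?_⟩
  · exact (hnorm u v h.ne).2 h
  · exact fun h1 => h' ((hnorm u v h).1 h1)
  · rintro h _ ⟨u, rfl⟩ _ ⟨v, rfl⟩
    exact h u v
  · rintro h _ ⟨u, rfl⟩ _ ⟨v, rfl⟩ hne hc
    exact hne (by rw [h hc])
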